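/- Circuits have gates of fan-in $2$ computing arbitrary Boolean functions, arbitrary depth and fan-out; their size is the number of gates. For a finite non-empty set $S$, a function $G:S\to\{0,1\}^{N}$ is a $4$-wise uniform generator if, for uniformly random $s\in S$ and every set $T$ of exactly $4$ coordinates, the restriction $G(s)_T$ is uniformly distributed over $\{0,1\}^4$. Index the coordinates of strings in $\{0,1\}^{2^n}$ by $x\in\{0,1\}^n$. Theorem. There are constants $c,k\in\mathbb{N}$ and $\delta>0$ such that for every $n\ge 1$ there is a $4$-wise uniform generator $G:\{0,1\}^{16n}\to\{0,1\}^{2^n}$ such that, for every seed $s\in\{0,1\}^{16n}$, there is a circuit $C_s$ of size at most $cn$ with $C_s(x)=G(s)_x$ for all $x\in\{0,1\}^n$. Moreover, $G$ can be taken of the following form: $$G(s)_x=\big\langle \big(g_1(\mathrm{Enc}(x)_{T_1}),\dots,g_{16n}(\mathrm{Enc}(x)_{T_{16n}})\big),\,s\big\rangle \quad (\text{inner product over }\mathbb{F}_2),$$ where $\mathrm{Enc}:\{0,1\}^n\to\{0,1\}^m$ with $m\le cn$ is computed by a circuit of size at most $cn$, the strings $\mathrm{Enc}(x)$ and $\mathrm{Enc}(y)$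 differ in at least $\delta m$ coordinates for all $x\ne y$, each $T_i\subseteq[m]$ has at most $k$ elements, and $g_i:\{0,1\}^{T_i}\to\{0,1\}$. -/

import Mathlib

/-- The gates of a Boolean circuit on `n` input bits, listed in topological order. A list of `t`
gates has the `n + t` wires `0, …, n + t - 1`: first the inputs, then the outputs of the gates.
Every new gate applies an arbitrary Boolean function of fan-in 2 to two earlier wires. -/
inductive GateList (n : ℕ) : ℕ → Type
  | inputs : GateList n 0
  | gate {t : ℕ} (c : GateList n t) (op : Bool → Bool → Bool) (i j : Fin (n + t)) :
      GateList n (t + 1)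

/-- The values of all the wires on the input `x`. -/
def GateList.wires {n : ℕ} : {t : ℕ} → GateList n t → (Fin n → Bool) → Fin (n + t) → Bool
  | _, .inputs, x => x
  | _, .gate c op i j, x =>
      Fin.snoc (α := fun _ => Bool) (c.wires x) (op (c.wires x i) (c.wires x j))

/-- A Boolean circuit (fan-in 2, arbitrary gates, arbitrary depth and fan-out) with `n` input bits
and `m` output bits. Each output bit is read off some wire. The size is the number of gates. -/
structure BoolCircuit (n m : ℕ) where
  size : ℕ
  gates : GateList n size
  output : Fin m → Fin (n + size)

/-- The function that a circuit computes. -/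
def BoolCircuit.eval {n m : ℕ} (C : BoolCircuit n m) (x : Fin n → Bool) : Fin m → Bool :=
  fun i => C.gates.wires x (C.output i)

/-- A distribution over `{0,1}^ι` is `k`-wise uniform if its marginal on every set of exactly `k`
coordinates is the uniform distribution. -/
def IsKWiseUniform {ι : Type*} [DecidableEq ι] (k : ℕ) (D : PMF (ι → Bool)) : Prop :=
  ∀ T : Finset ι, T.card = k → D.map T.restrict = PMF.uniformOfFintype (T → Bool)

/-- `G : S → {0,1}^ι` is a `k`-wise uniform generator if `G s`, for a uniformly random seed `s`,
has a `k`-wise uniform distribution. -/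
def IsKWiseUniformGenerator {S ι : Type*} [Fintype S] [Nonempty S] [DecidableEq ι] (k : ℕ)
    (G : S → ι → Bool) : Prop :=
  IsKWiseUniform k ((PMF.uniformOfFintype S).map G)

/-- The inner product over `𝔽₂` of two bit strings: the parity of the number of common ones. -/
def bitInner {r : ℕ} (a b : Fin r → Bool) : Bool :=
  decide (Odd (Finset.univ.filter fun i => a i = true ∧ b i = true).card)

/-! A map s ↦ (⟨H(x), s⟩)_x is 4-wise uniform as soon as no nonempty set of at most four rows H(x)
sums to zero over 𝔽₂ (`isKWiseUniformGenerator_bitInner`). The rows consist of local functions of a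
codeword, chosen by the probabilistic method. On a set of at most four codewords, k random
coordinates separate one word from the others with probability at least 4/5, and a random function
of the bits read then has odd parity with probability exactly 1/2. With 16n independent local
functions the failure probability beats a union bound over the 16^n quadruples of inputs
(`exists_localFun_odd`).

The same lemma builds the code (`exists_linear_size_code`). A sparse matrix A compresses n bits to
n/2 bits without killing any nonzero vector of small weight (`exists_sparse_check`). With E' the
code for n/2 bits, the codeword of x is x followed by 16n local functions of E'(Ax). Inputs that are
far apart differ enough in the first block. Close ones have Ax ≠ Ay, so E' separates them well and
at least n local functions differ. Each level costs O(n) gates and halves n, so the total is linear;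
the distance does not degrade because every level restores it. -/

/-! ### Gate counting for Boolean circuits. -/

/-- Some circuit with at most `t` gates has all functions of `F` among its wires. -/
def Computes (n t : ℕ) (F : Set ((Fin n → Bool) → Bool)) : Prop :=
  ∃ s ≤ t, ∃ c : GateList n s, ∀ f ∈ F, ∃ i, ∀ x, c.wires x i = f x

/-- Every circuit that has the functions of `F` among its wires can be extended by at most `t` gates
so that it also has the functions of `F'` among them. -/
def Derives {n : ℕ} (F : Set ((Fin n → Bool) → Bool)) (t : ℕ)
    (F' : Set ((Fin n → Bool) → Bool)) : Prop :=
  ∀ s F₀, F ⊆ F₀ → Computes n s F₀ → Computes n (s + t) (F₀ ∪ F')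

theorem Computes.mono {n s t : ℕ} {F F' : Set ((Fin n → Bool) → Bool)} (h : Computes n s F)
    (hst : s ≤ t) (hF : F' ⊆ F) : Computes n t F' := by
  obtain ⟨r, hr, c, hc⟩ := h
  exact ⟨r, hr.trans hst, c, fun f hf => hc f (hF hf)⟩

theorem Computes.inputs (n : ℕ) : Computes n 0 (Set.range fun i x => x i) := by
  refine ⟨0, le_rfl, .inputs, ?_⟩
  rintro _ ⟨i, rfl⟩
  exact ⟨i, fun x => rfl⟩

theorem Computes.exists_circuit {n m t : ℕ} {F : Set ((Fin n → Bool) → Bool)}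
    (h : Computes n t F) (f : Fin m → (Fin n → Bool) → Bool) (hf : ∀ i, f i ∈ F) :
    ∃ C : BoolCircuit n m, C.size ≤ t ∧ ∀ x i, C.eval x i = f i x := by
  obtain ⟨s, hs, c, hc⟩ := h
  choose o ho using fun i => hc (f i) (hf i)
  exact ⟨⟨s, c, o⟩, hs, fun x i => ho i x⟩

namespace Derives

variable {n : ℕ} {F F₁ F₂ F₃ : Set ((Fin n → Bool) → Bool)} {s t : ℕ}

theorem computes (h : Derives F t F₁) (hF : Computes n s F) : Computes n (s + t) (F ∪ F₁) :=
  h s F subset_rfl hF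

theorem mono_left (h : Derives F t F₁) (hF : F ⊆ F₂) : Derives F₂ t F₁ :=
  fun s F₀ hF₀ hc => h s F₀ (hF.trans hF₀) hc

theorem mono_size (h : Derives F s F₁) (hst : s ≤ t) : Derives F t F₁ :=
  fun r F₀ hF₀ hc => (h r F₀ hF₀ hc).mono (by omega) subset_rfl

theorem mono_right (h : Derives F t F₁) (hF : F₂ ⊆ F₁) : Derives F t F₂ :=
  fun r F₀ hF₀ hc => (h r F₀ hF₀ hc).mono le_rfl (Set.union_subset_union_right _ hF)

theorem of_subset (h : F₁ ⊆ F) : Derives F 0 F₁ :=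
  fun _ _ hF₀ hc => hc.mono le_rfl (Set.union_subset subset_rfl (h.trans hF₀))

/-- Costs add because a derivation extends any circuit that already has the wires of `F`: gates
built earlier are kept and shared. -/
theorem trans (h : Derives F s F₁) (h' : Derives (F ∪ F₁) t F₂) :
    Derives F (s + t) (F₁ ∪ F₂) := fun r F₀ hF₀ hc => by
  have := h' _ _ (Set.union_subset_union_left F₁ hF₀) (h r F₀ hF₀ hc)
  rwa [Set.union_assoc, add_assoc] at this

theorem union (h : Derives F s F₁) (h' : Derives F t F₂) : Derives F (s + t) (F₁ ∪ F₂) :=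
  h.trans (h'.mono_left Set.subset_union_left)

theorem biUnion {ι : Type*} (I : Finset ι) (t : ι → ℕ) (F' : ι → Set ((Fin n → Bool) → Bool))
    (h : ∀ i ∈ I, Derives F (t i) (F' i)) : Derives F (∑ i ∈ I, t i) (⋃ i ∈ I, F' i) := by
  classical
  induction I using Finset.induction_on with
  | empty => exact of_subset (by simp)
  | insert a I ha ih =>
    rw [Finset.sum_insert ha, Finset.set_biUnion_insert]
    exact (h a (by simp)).union (ih fun i hi => h i (by simp [hi]))

theorem range {ι : Type*} [Fintype ι] (t : ι → ℕ) (f : ι → (Fin n → Bool) → Bool)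
    (h : ∀ i, Derives F (t i) {f i}) : Derives F (∑ i, t i) (Set.range f) := by
  refine (biUnion Finset.univ t (fun i => {f i}) fun i _ => h i).mono_right ?_
  rintro _ ⟨i, rfl⟩
  simp

theorem gate (op : Bool → Bool → Bool) {f g : (Fin n → Bool) → Bool} (hf : f ∈ F) (hg : g ∈ F) :
    Derives F 1 {fun x => op (f x) (g x)} := by
  rintro r F₀ hF₀ ⟨q, hq, c, hc⟩
  obtain ⟨i, hi⟩ := hc f (hF₀ hf)
  obtain ⟨j, hj⟩ := hc g (hF₀ hg)
  refine ⟨q + 1, by omega, c.gate op i j, ?_⟩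
  rintro e (he | rfl)
  · obtain ⟨l, hl⟩ := hc e he
    refine ⟨Fin.castSucc l, fun x => ?_⟩
    rw [← hl x]
    exact Fin.snoc_castSucc (α := fun _ => Bool) _ _ l
  · refine ⟨Fin.last (n + q), fun x => ?_⟩
    show _ = op (f x) (g x)
    rw [← hi x, ← hj x]
    exact Fin.snoc_last (α := fun _ => Bool) _ _

theorem const (hF : F.Nonempty) (b : Bool) : Derives F 1 {fun _ => b} := by
  obtain ⟨f, hf⟩ := hF
  exact gate (fun _ _ => b) hf hf

/-- One gate for the constant `false`, then one xor per term. `F` must be nonempty because even a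
constant gate needs wires to read. -/
theorem parity {ι : Type*} [DecidableEq ι] (hF : F.Nonempty) (I : Finset ι)
    (f : ι → (Fin n → Bool) → Bool) (hf : ∀ i ∈ I, f i ∈ F) :
    Derives F (I.card + 1) {fun x => decide (Odd (I.filter fun i => f i x = true).card)} := by
  induction I using Finset.induction_on with
  | empty => simpa using const hF false
  | insert a I ha ih =>
    have h := (ih fun i hi => hf i (by simp [hi])).trans
      (gate (F := _ ∪ _) Bool.xor (Or.inl (hf a (by simp))) (Or.inr rfl))
    rw [Finset.card_insert_of_notMem ha]
    refine h.mono_right ?_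
    rintro _ rfl
    refine Or.inr ?_
    rw [Set.mem_singleton_iff]
    funext x
    rw [Finset.filter_insert]
    by_cases hx : f a x = true
    · have : a ∉ I.filter fun i => f i x = true := fun h => ha (Finset.mem_filter.1 h).1
      rw [if_pos hx, Finset.card_insert_of_notMem this, hx]
      simp [Nat.odd_add_one, -Nat.not_odd_iff_even]
    · rw [if_neg hx]
      simp [hx]

/-- Shannon expansion on the first variable: two functions of one variable fewer and three gates to
select between them. -/
theorem comp {k : ℕ} (hF : F.Nonempty) (φ : (Fin k → Bool) → Bool)
    (f : Fin k → (Fin n → Bool) → Bool) (hf : ∀ i, f i ∈ F) :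
    Derives F (4 ^ (k + 1)) {fun x => φ fun i => f i x} := by
  induction k with
  | zero =>
    refine (const hF (φ Fin.elim0)).mono_size (by norm_num) |>.mono_right ?_
    rintro _ rfl
    rw [Set.mem_singleton_iff]
    funext x
    exact congrArg φ (Subsingleton.elim _ _)
  | succ k ih =>
    have h (b : Bool) := ih (fun y => φ (Fin.cons b y)) (fun i => f i.succ) fun i => hf _
    have h1 := (h true).union (h false)
    have h2 := h1.trans (gate (F := _ ∪ _) (fun a b => a && b) (Or.inl (hf 0)) (Or.inr (Or.inl rfl)))
    have h3 := h2.trans (gate (F := _ ∪ _) (fun a b => !a && b) (Or.inl (hf 0))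
      (Or.inr (Or.inl (Or.inr rfl))))
    have h4 := h3.trans (gate (F := _ ∪ _) (fun a b => a || b)
      (Or.inr (Or.inl (Or.inr rfl))) (Or.inr (Or.inr rfl)))
    refine (h4.mono_size ?_).mono_right ?_
    · have : 1 ≤ 4 ^ k := Nat.one_le_pow _ _ (by norm_num)
      rw [pow_succ 4 (k + 1), pow_succ 4 k]
      omega
    · rintro _ rfl
      refine Or.inr ?_
      rw [Set.mem_singleton_iff]
      funext x
      have : (fun i => f i x) = Fin.cons (f 0 x) fun i : Fin k => f i.succ x :=
        (Fin.cons_self_tail (α := fun _ => Bool) fun i => f i x).symm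
      rw [this]
      cases f 0 x <;> simp

theorem subst {m q : ℕ} (c : GateList m q) (f : Fin m → (Fin n → Bool) → Bool)
    (hf : ∀ i, f i ∈ F) :
    Derives F q (Set.range fun i x => c.wires (fun j => f j x) i) := by
  induction c with
  | inputs =>
    apply of_subset
    rintro _ ⟨i, rfl⟩
    exact hf i
  | gate c op i j ih =>
    refine (ih.trans (gate (F := _ ∪ _) op (Or.inr ⟨i, rfl⟩) (Or.inr ⟨j, rfl⟩))).mono_right ?_
    rintro _ ⟨l, rfl⟩
    refine Fin.lastCases ?_ (fun l => ?_) l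
    · refine Or.inr ?_
      rw [Set.mem_singleton_iff]
      funext x
      exact Fin.snoc_last (α := fun _ => Bool) _ _
    · refine Or.inl ⟨l, ?_⟩
      funext x
      exact (Fin.snoc_castSucc (α := fun _ => Bool) _ _ l).symm

end Derives

/-! ### Random local functions on a good code. -/

/-- A Boolean function of `m` bits that depends on at most `k` coordinates, given by the list of
these coordinates and a function of `k` bits. -/
abbrev LocalFun (m k : ℕ) : Type := (Fin k → Fin m) × ((Fin k → Bool) → Bool)

/-- The value of a local function. -/
def LocalFun.eval {m k : ℕ} (o : LocalFun m k) (z : Fin m → Bool) : Bool := o.2 (z ∘ o.1)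

/-- A uniformly random Boolean function has odd parity with probability `1/2` on a family of points
in which one point occurs only once. -/
theorem two_mul_card_odd_eq_card {X B : Type*} [DecidableEq X] [Fintype B] [DecidableEq B]
    (S : Finset X) (E : X → B) {a : X} (ha : a ∈ S) (h : ∀ y ∈ S, y ≠ a → E y ≠ E a) :
    2 * (Finset.univ.filter fun φ : B → Bool =>
      Odd (S.filter fun x => φ (E x) = true).card).card = Fintype.card (B → Bool) := by
  -- Only `a` is sent to `E a`, so toggling `φ` there is an involution that exchanges odd and even
  -- parity.
  let flip : (B → Bool) → (B → Bool) := fun φ => Function.update φ (E a) (!φ (E a))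
  have hinv (φ) : flip (flip φ) = φ := by simp [flip]
  have hflip (φ) : Odd (S.filter fun x => flip φ (E x) = true).card ↔
      ¬ Odd (S.filter fun x => φ (E x) = true).card := by
    have hcongr : ((S.erase a).filter fun x => flip φ (E x) = true) =
        (S.erase a).filter fun x => φ (E x) = true := by
      refine Finset.filter_congr fun x hx => ?_
      rw [Finset.mem_erase] at hx
      simp [flip, Function.update_of_ne (h x hx.2 hx.1)]
    have hna (ψ : B → Bool) : a ∉ (S.erase a).filter fun x => ψ (E x) = true := by simp
    rw [← Finset.insert_erase ha, Finset.filter_insert, Finset.filter_insert, hcongr]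
    cases hφ : φ (E a)
    · rw [if_pos (by simp [flip, hφ]), if_neg (by simp), Finset.card_insert_of_notMem (hna φ),
        Nat.odd_add_one]
    · rw [if_neg (by simp [flip, hφ]), if_pos rfl, Finset.card_insert_of_notMem (hna φ),
        Nat.odd_add_one, not_not]
  have hcard : (Finset.univ.filter fun φ : B → Bool =>
      Odd (S.filter fun x => φ (E x) = true).card).card = (Finset.univ.filter fun φ : B → Bool =>
      ¬ Odd (S.filter fun x => φ (E x) = true).card).card := by
    refine Finset.card_nbij' flip flip ?_ ?_ (fun φ _ => hinv φ) (fun φ _ => hinv φ)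
    · intro φ hφ
      simpa [hflip, -Nat.not_odd_iff_even] using hφ
    · intro φ hφ
      simpa [hflip, -Nat.not_odd_iff_even] using hφ
  have := Finset.card_filter_add_card_filter_not (s := (Finset.univ : Finset (B → Bool)))
    (fun φ : B → Bool => Odd (S.filter fun x => φ (E x) = true).card)
  rw [Finset.card_univ] at this
  omega

/-- Few tuples of coordinates fail to separate two words at a large distance. -/
theorem card_comp_eq_le {m k : ℕ} {δ : ℝ} {y z : Fin m → Bool}
    (h : δ * m ≤ (hammingDist y z : ℝ)) :
    ((Finset.univ.filter fun T : Fin k → Fin m => y ∘ T = z ∘ T).card : ℝ) ≤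
      (1 - δ) ^ k * (m : ℝ) ^ k := by
  have hT : (Finset.univ.filter fun T : Fin k → Fin m => y ∘ T = z ∘ T) =
      Fintype.piFinset fun _ => Finset.univ.filter fun i => y i = z i := by
    ext T
    simp [funext_iff]
  have hsum : (Finset.univ.filter fun i => y i = z i).card + hammingDist y z = m := by
    have := Finset.card_filter_add_card_filter_not (s := (Finset.univ : Finset (Fin m)))
      (fun i => y i = z i)
    simpa [hammingDist] using this
  rw [hT, Fintype.card_piFinset_const, ← mul_pow]
  push_cast
  refine pow_le_pow_left₀ (Nat.cast_nonneg _) ?_ k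
  have : ((Finset.univ.filter fun i => y i = z i).card : ℝ) + hammingDist y z = m := by
    exact_mod_cast hsum
  linarith

/-- On at most four codewords of a good code, a random local function has odd parity with
probability at least `2/5`. -/
theorem two_mul_card_localFun_le {X : Type*} [DecidableEq X] {m k : ℕ} {δ : ℝ}
    (E : X → Fin m → Bool) (hE : ∀ x y, x ≠ y → δ * m ≤ (hammingDist (E x) (E y) : ℝ))
    (hk : (1 - δ) ^ k ≤ 1 / 15) (S : Finset X) (hS : S.Nonempty) (hS4 : S.card ≤ 4) :
    2 * (Fintype.card (LocalFun m k) : ℝ) ≤ 5 * ((Finset.univ.filter fun o : LocalFun m k =>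
      Odd (S.filter fun x => o.eval (E x) = true).card).card : ℝ) := by
  obtain ⟨a, ha⟩ := hS
  set P : Finset (Fin k → Fin m) :=
    Finset.univ.filter fun T => ∀ y ∈ S, y ≠ a → E y ∘ T ≠ E a ∘ T with hP
  set Q : Finset (Fin k → Fin m) :=
    Finset.univ.filter fun T => ¬ ∀ y ∈ S, y ≠ a → E y ∘ T ≠ E a ∘ T with hQ
  have hPQ : (P.card : ℝ) + Q.card = (m : ℝ) ^ k := by
    have := Finset.card_filter_add_card_filter_not
      (s := (Finset.univ : Finset (Fin k → Fin m)))
      (fun T => ∀ y ∈ S, y ≠ a → E y ∘ T ≠ E a ∘ T)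
    rw [Finset.card_univ, Fintype.card_fun, Fintype.card_fin, Fintype.card_fin] at this
    exact_mod_cast this
  -- At most three points differ from `a`, and each collides with it on a fraction at most 1/15 of
  -- the tuples. This leaves 4/5 of the tuples, half of the functions on each, hence 2/5.
  have hQle : (Q.card : ℝ) ≤ 1 / 5 * (m : ℝ) ^ k := by
    have hsub : Q ⊆ (S.erase a).biUnion fun y =>
        Finset.univ.filter fun T : Fin k → Fin m => E y ∘ T = E a ∘ T := by
      intro T hT
      simp only [hQ, Finset.mem_filter, Finset.mem_univ, true_and] at hT
      push Not at hT
      obtain ⟨y, hy, hya, he⟩ := hT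
      simp only [Finset.mem_biUnion, Finset.mem_erase, Finset.mem_filter, Finset.mem_univ,
        true_and]
      exact ⟨y, ⟨hya, hy⟩, he⟩
    have h1 : (Q.card : ℝ) ≤ ∑ y ∈ S.erase a,
        ((Finset.univ.filter fun T : Fin k → Fin m => E y ∘ T = E a ∘ T).card : ℝ) := by
      exact_mod_cast (Finset.card_le_card hsub).trans Finset.card_biUnion_le
    have h2 : ∀ y ∈ S.erase a,
        ((Finset.univ.filter fun T : Fin k → Fin m => E y ∘ T = E a ∘ T).card : ℝ) ≤
          1 / 15 * (m : ℝ) ^ k := fun y hy =>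
      (card_comp_eq_le (hE y a (Finset.ne_of_mem_erase hy))).trans
        (mul_le_mul_of_nonneg_right hk (by positivity))
    have h3 : ((S.erase a).card : ℝ) ≤ 3 := by
      rw [Finset.card_erase_of_mem ha]
      exact_mod_cast (by omega : S.card - 1 ≤ 3)
    have h4 := h1.trans (Finset.sum_le_card_nsmul _ _ _ h2)
    rw [nsmul_eq_mul] at h4
    have h5 : (0 : ℝ) ≤ (m : ℝ) ^ k := by positivity
    nlinarith
  have hsub : P.biUnion (fun T => (Finset.univ.filter fun φ : (Fin k → Bool) → Bool =>
      Odd (S.filter fun x => φ (E x ∘ T) = true).card).image fun φ => (T, φ)) ⊆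
      Finset.univ.filter fun o : LocalFun m k =>
        Odd (S.filter fun x => o.eval (E x) = true).card := by
    intro o ho
    simp only [Finset.mem_biUnion, Finset.mem_image, Finset.mem_filter, Finset.mem_univ,
      true_and] at ho
    obtain ⟨T, -, φ, hφ, rfl⟩ := ho
    exact Finset.mem_filter.2 ⟨Finset.mem_univ _, hφ⟩
  have hcard := Finset.card_le_card hsub
  rw [Finset.card_biUnion] at hcard
  · have hhalf (T) (hT : T ∈ P) : (Fintype.card ((Fin k → Bool) → Bool) : ℝ) / 2 =
        (((Finset.univ.filter fun φ : (Fin k → Bool) → Bool =>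
          Odd (S.filter fun x => φ (E x ∘ T) = true).card).image fun φ => (T, φ)).card : ℝ) := by
      rw [Finset.card_image_of_injective _ (Prod.mk_right_injective T),
        ← two_mul_card_odd_eq_card S (fun x => E x ∘ T) ha (Finset.mem_filter.1 hT).2]
      push_cast
      ring
    have hcard' : (P.card : ℝ) * ((Fintype.card ((Fin k → Bool) → Bool) : ℝ) / 2) ≤
        ((Finset.univ.filter fun o : LocalFun m k =>
          Odd (S.filter fun x => o.eval (E x) = true).card).card : ℝ) := by
      rw [← nsmul_eq_mul, ← Finset.sum_const, Finset.sum_congr rfl hhalf]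
      exact_mod_cast hcard
    have hΩ : (Fintype.card (LocalFun m k) : ℝ) =
        (m : ℝ) ^ k * Fintype.card ((Fin k → Bool) → Bool) := by
      rw [Fintype.card_prod, Nat.cast_mul, Fintype.card_fun (α := Fin k) (β := Fin m),
        Fintype.card_fin, Fintype.card_fin, Nat.cast_pow]
    rw [hΩ]
    have h0 : (0 : ℝ) ≤ (Fintype.card ((Fin k → Bool) → Bool) : ℝ) := Nat.cast_nonneg _
    nlinarith
  · intro T _ T' _ hTT'
    simp only [Function.onFun]
    rw [Finset.disjoint_left]
    intro o ho ho'
    simp only [Finset.mem_image] at ho ho'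
    obtain ⟨φ, -, rfl⟩ := ho
    obtain ⟨φ', -, h⟩ := ho'
    exact hTT' (Prod.mk.inj h).1.symm

/-- There are `N` local functions such that, on every set of at most four codewords of a good code,
at least `t` of them have odd parity. -/
theorem exists_localFun_odd {X : Type*} [Fintype X] [DecidableEq X] {m k N t : ℕ} {δ : ℝ}
    (hm : 0 < m) (E : X → Fin m → Bool)
    (hE : ∀ x y, x ≠ y → δ * m ≤ (hammingDist (E x) (E y) : ℝ)) (hk : (1 - δ) ^ k ≤ 1 / 15)
    (hN : (2 : ℝ) ^ t * (Fintype.card X : ℝ) ^ 4 * (4 / 5) ^ N < 1) :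
    ∃ ω : Fin N → LocalFun m k, ∀ S : Finset X, S.Nonempty → S.card ≤ 4 →
      t ≤ (Finset.univ.filter fun j =>
        Odd (S.filter fun x => (ω j).eval (E x) = true).card).card := by
  -- Exponential moment: the product of the weights is 2 to the minus the number of odd functions,
  -- and the mean of one weight is at most 1 - (2/5)/2 = 4/5.
  let w : Finset X → LocalFun m k → ℝ := fun S o =>
    if Odd (S.filter fun x => o.eval (E x) = true).card then 1 / 2 else 1
  have hw0 (S o) : 0 ≤ w S o := by
    dsimp only [w]
    split_ifs <;> norm_num
  have hΩ : (0 : ℝ) < Fintype.card (LocalFun m k) := by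
    have : Nonempty (Fin m) := ⟨⟨0, hm⟩⟩
    exact_mod_cast Fintype.card_pos
  have hw (S : Finset X) (hS : S.Nonempty) (hS4 : S.card ≤ 4) :
      ∑ o, w S o ≤ 4 / 5 * Fintype.card (LocalFun m k) := by
    have h1 := two_mul_card_localFun_le E hE hk S hS hS4
    have h2 := Finset.card_filter_add_card_filter_not
      (s := (Finset.univ : Finset (LocalFun m k)))
      (fun o => Odd (S.filter fun x => o.eval (E x) = true).card)
    have h3 : ((Finset.univ.filter fun o : LocalFun m k =>
        Odd (S.filter fun x => o.eval (E x) = true).card).card : ℝ) +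
        (Finset.univ.filter fun o : LocalFun m k =>
        ¬ Odd (S.filter fun x => o.eval (E x) = true).card).card =
        Fintype.card (LocalFun m k) := by
      rw [Finset.card_univ] at h2
      exact_mod_cast h2
    dsimp only [w]
    rw [Finset.sum_ite, Finset.sum_const, Finset.sum_const, nsmul_eq_mul, nsmul_eq_mul]
    linarith
  -- Sets of one to four points are the images of 4-tuples, so the union bound has `|X|^4` terms.
  let im : (Fin 4 → X) → Finset X := fun u => Finset.univ.image u
  have him (u) : (im u).Nonempty ∧ (im u).card ≤ 4 :=
    ⟨Finset.univ_nonempty.image u, by simpa using Finset.card_image_le (s := Finset.univ) (f := u)⟩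
  have hsurj (S : Finset X) (hS : S.Nonempty) (hS4 : S.card ≤ 4) : ∃ u, im u = S := by
    have : Nonempty S := hS.to_subtype
    obtain ⟨e⟩ := Function.Embedding.nonempty_of_card_le (α := S) (β := Fin 4) (by simpa using hS4)
    refine ⟨fun i => (Function.invFun e i : S), ?_⟩
    ext x
    simp only [im, Finset.mem_image, Finset.mem_univ, true_and]
    constructor
    · rintro ⟨i, rfl⟩
      exact (Function.invFun e i).2
    · intro hx
      exact ⟨e ⟨x, hx⟩, by rw [Function.leftInverse_invFun e.injective]⟩
  by_contra! hbad
  have hlow (ω : Fin N → LocalFun m k) :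
      (1 / 2 : ℝ) ^ t ≤ ∑ u : Fin 4 → X, ∏ j, w (im u) (ω j) := by
    obtain ⟨S, hS, hS4, hlt⟩ := hbad ω
    obtain ⟨u, rfl⟩ := hsurj S hS hS4
    refine le_trans ?_ (Finset.single_le_sum (f := fun u : Fin 4 → X => ∏ j, w (im u) (ω j))
      (fun u _ => Finset.prod_nonneg fun j _ => hw0 _ _) (Finset.mem_univ u))
    dsimp only [w]
    rw [Finset.prod_ite, Finset.prod_const, Finset.prod_const_one, mul_one]
    exact pow_le_pow_of_le_one (by norm_num) (by norm_num) hlt.le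
  have htotal := Finset.sum_le_sum fun ω (_ : ω ∈ Finset.univ) => hlow ω
  rw [Finset.sum_comm, Finset.sum_const, nsmul_eq_mul, Finset.card_univ, Fintype.card_fun,
    Fintype.card_fin, Nat.cast_pow] at htotal
  have hup : ∑ u : Fin 4 → X, ∑ ω : Fin N → LocalFun m k, ∏ j, w (im u) (ω j) ≤
      ∑ _u : Fin 4 → X, (4 / 5 * (Fintype.card (LocalFun m k) : ℝ)) ^ N := by
    refine Finset.sum_le_sum fun u _ => ?_
    rw [← Fintype.sum_pow]
    exact pow_le_pow_left₀ (Finset.sum_nonneg fun o _ => hw0 _ _) (hw _ (him u).1 (him u).2) N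
  rw [Finset.sum_const, nsmul_eq_mul, Finset.card_univ, Fintype.card_fun, Fintype.card_fin,
    Nat.cast_pow, mul_pow] at hup
  have h := htotal.trans hup
  have hpos : (0 : ℝ) < (Fintype.card (LocalFun m k) : ℝ) ^ N := pow_pos hΩ N
  have h2 : (1 / 2 : ℝ) ^ t ≤ (Fintype.card X : ℝ) ^ 4 * (4 / 5) ^ N := by
    refine le_of_mul_le_mul_left ?_ hpos
    calc _ ≤ _ := h
      _ = _ := by ring
  have h3 : (1 : ℝ) = 2 ^ t * (1 / 2) ^ t := by rw [← mul_pow]; norm_num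
  have h4 := mul_le_mul_of_nonneg_left h2 (by positivity : (0 : ℝ) ≤ 2 ^ t)
  rw [← h3, ← mul_assoc] at h4
  exact absurd hN (not_lt.2 h4)

/-! ### Sparse matrices that annihilate no nonzero vector of small weight. -/

theorem choose_le_three_mul_div_pow (n : ℕ) {s : ℕ} (hs : 0 < s) :
    (n.choose s : ℝ) ≤ (3 * n / s) ^ s := by
  have hs' : (0 : ℝ) < s := by exact_mod_cast hs
  have hfac : (0 : ℝ) < (s.factorial : ℝ) := by exact_mod_cast s.factorial_pos
  have h1 : (s : ℝ) ^ s / s.factorial ≤ 3 ^ s := by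
    refine (Real.pow_div_factorial_le_exp (s : ℝ) hs'.le s).trans ?_
    rw [← mul_one (s : ℝ), Real.exp_nat_mul]
    exact pow_le_pow_left₀ (Real.exp_pos 1).le (by linarith [Real.exp_one_lt_d9]) s
  refine (Nat.choose_le_pow_div s n).trans ?_
  rw [div_le_iff₀ hfac] at h1 ⊢
  rw [div_pow, mul_pow, div_mul_eq_mul_div, le_div_iff₀ (pow_pos hs' s)]
  have h2 : (0 : ℝ) ≤ (n : ℝ) ^ s := by positivity
  nlinarith [mul_le_mul_of_nonneg_left h1 h2]

/-- The union bound over the pairs of an `s`-set of columns and a `2s`-set of rows. -/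
theorem choose_mul_choose_mul_le {n M s : ℕ} (hs : 0 < s) (hsn : 4000 * s ≤ n) (hM : n ≤ 3 * M) :
    (n.choose s : ℝ) * M.choose (2 * s) * ((2 * s : ℝ) ^ 4) ^ s ≤ (1 / 4) ^ s * ((M : ℝ) ^ 4) ^ s := by
  have hs' : (0 : ℝ) < s := by exact_mod_cast hs
  have hsn' : (4000 * s : ℝ) ≤ n := by exact_mod_cast hsn
  have hM' : (n : ℝ) ≤ 3 * M := by exact_mod_cast hM
  have h1 := choose_le_three_mul_div_pow n hs
  have h2 := choose_le_three_mul_div_pow M (s := 2 * s) (by omega)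
  have h3 : (n.choose s : ℝ) * M.choose (2 * s) * ((2 * s : ℝ) ^ 4) ^ s ≤
      (3 * n / s) ^ s * (3 * M / (2 * s : ℕ)) ^ (2 * s) * ((2 * s : ℝ) ^ 4) ^ s := by
    gcongr
  refine h3.trans ?_
  rw [pow_mul, ← mul_pow, ← mul_pow, ← mul_pow]
  refine pow_le_pow_left₀ (by positivity) ?_ s
  have h4 : (3 * n / s : ℝ) * (3 * M / (2 * s : ℕ)) ^ 2 * (2 * s : ℝ) ^ 4 =
      108 * (n * s) * (M : ℝ) ^ 2 := by
    push_cast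
    field_simp
    ring
  rw [h4]
  -- From `4000 s ≤ n ≤ 3M`: 432 n s ≤ (432 · 9 / 4000) M², and 432 · 9 = 3888. This is the source
  -- of 4000.
  have h5 : 432 * ((n : ℝ) * s) ≤ (M : ℝ) ^ 2 := by nlinarith
  have h6 : (0 : ℝ) ≤ (M : ℝ) ^ 2 := by positivity
  nlinarith

/-- A random `f` sends all four entries of the columns in `S` into `T` with probability
(|T|/M)^(4|S|), written here without division. -/
theorem card_filter_map_into {n M : ℕ} (S : Finset (Fin n)) (T : Finset (Fin M)) :
    ((Finset.univ.filter fun f : Fin n × Fin 4 → Fin M => ∀ i ∈ S, ∀ l, f (i, l) ∈ T).card : ℝ) *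
      ((M : ℝ) ^ 4) ^ S.card = ((T.card : ℝ) ^ 4) ^ S.card * ((M : ℝ) ^ 4) ^ n := by
  have h : (Finset.univ.filter fun f : Fin n × Fin 4 → Fin M => ∀ i ∈ S, ∀ l, f (i, l) ∈ T) =
      Fintype.piFinset fun p => if p.1 ∈ S then T else Finset.univ := by
    ext f
    simp only [Finset.mem_filter, Finset.mem_univ, true_and, Fintype.mem_piFinset, Prod.forall]
    refine forall_congr' fun i => ?_
    by_cases hi : i ∈ S <;> simp [hi]
  have hprod : (Fintype.piFinset fun p : Fin n × Fin 4 =>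
      if p.1 ∈ S then T else Finset.univ).card =
      (T.card ^ 4) ^ S.card * (M ^ 4) ^ (Finset.univ.filter fun i => i ∉ S).card := by
    rw [Fintype.card_piFinset, Fintype.prod_prod_type]
    have (i : Fin n) : ∏ _l : Fin 4, (if i ∈ S then T else Finset.univ).card =
        if i ∈ S then T.card ^ 4 else M ^ 4 := by
      split_ifs <;> simp
    simp only [this]
    rw [Finset.prod_ite, Finset.prod_const, Finset.prod_const]
    simp
  have hcard := Finset.card_filter_add_card_filter_not
    (s := (Finset.univ : Finset (Fin n))) (fun i => i ∈ S)
  rw [Finset.filter_mem_eq_inter, Finset.univ_inter, Finset.card_univ, Fintype.card_fin] at hcard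
  rw [h, hprod]
  push_cast
  rw [mul_assoc, ← pow_add, add_comm, hcard]

theorem sum_Icc_one_fourth_pow_lt_one (q : ℕ) : ∑ s ∈ Finset.Icc 1 q, (1 / 4 : ℝ) ^ s < 1 := by
  have h : ∑ s ∈ Finset.Icc 1 q, (1 / 4 : ℝ) ^ s = (1 - (1 / 4) ^ q) / 3 := by
    induction q with
    | zero => simp
    | succ q ih =>
      rw [Finset.sum_Icc_succ_top (by omega), ih, pow_succ]
      ring
  rw [h]
  have : (0 : ℝ) < (1 / 4) ^ q := by positivity
  linarith

/-- There is a sparse parity-check matrix with `n` columns and `n / 2` rows, given by the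
positions `f (i, l)` of the four ones of every column `i`, that does not annihilate any nonzero
vector of small weight. -/
theorem exists_sparse_check (n : ℕ) (hn : 2 ≤ n) :
    ∃ f : Fin n × Fin 4 → Fin (n / 2), ∀ S : Finset (Fin n), S.Nonempty → 4000 * S.card ≤ n →
      ∃ j, Odd ((S ×ˢ Finset.univ).filter fun p => f p = j).card := by
  set M := n / 2 with hM
  have hM0 : 0 < M := by omega
  have hM3 : n ≤ 3 * M := by omega
  by_contra! hbad
  let Z : Finset (Fin n) → Finset (Fin M) → Finset (Fin n × Fin 4 → Fin M) := fun S T =>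
    Finset.univ.filter fun f => ∀ i ∈ S, ∀ l, f (i, l) ∈ T
  have hcover : (Finset.univ : Finset (Fin n × Fin 4 → Fin M)) ⊆
      (Finset.Icc 1 (n / 4000)).biUnion fun s => (Finset.powersetCard s Finset.univ).biUnion
        fun S => (Finset.powersetCard (2 * s) Finset.univ).biUnion fun T => Z S T := by
    intro f _
    obtain ⟨S, hS, hSn, heven⟩ := hbad f
    -- If all row parities are even, every row that is hit is hit at least twice, so the 4|S|
    -- entries occupy at most 2|S| rows. Coinciding entries of a column are counted with
    -- multiplicity.
    have himg : ((S ×ˢ Finset.univ).image f).card ≤ 2 * S.card := by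
      have h2 : ∀ j ∈ (S ×ˢ Finset.univ).image f,
          2 ≤ ((S ×ˢ Finset.univ).filter fun p => f p = j).card := by
        intro j hj
        obtain ⟨p, hp, rfl⟩ := Finset.mem_image.1 hj
        have hpos : 0 < ((S ×ˢ Finset.univ).filter fun p' => f p' = f p).card :=
          Finset.card_pos.2 ⟨p, Finset.mem_filter.2 ⟨hp, rfl⟩⟩
        obtain ⟨r, hr⟩ := (by simpa using heven (f p) :
          Even ((S ×ˢ Finset.univ).filter fun p' => f p' = f p).card)
        omega
      have h3 := Finset.card_nsmul_le_sum _ _ _ h2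
      rw [← Finset.card_eq_sum_card_image, Finset.card_product, Finset.card_univ,
        Fintype.card_fin, smul_eq_mul] at h3
      omega
    obtain ⟨T, hT, hTc⟩ := Finset.exists_superset_card_eq himg
      (by rw [Fintype.card_fin]; omega)
    simp only [Finset.mem_biUnion, Finset.mem_Icc, Finset.mem_powersetCard_univ]
    refine ⟨S.card, ⟨hS.card_pos, by omega⟩, S, rfl, T, hTc, ?_⟩
    refine Finset.mem_filter.2 ⟨Finset.mem_univ _, fun i hi l => hT ?_⟩
    exact Finset.mem_image.2 ⟨(i, l), by simp [hi], rfl⟩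
  have hMpos : (0 : ℝ) < (M : ℝ) := by exact_mod_cast hM0
  have hle := (Finset.card_le_card hcover).trans Finset.card_biUnion_le
  have hterm : ∀ s ∈ Finset.Icc 1 (n / 4000),
      (((Finset.powersetCard s (Finset.univ : Finset (Fin n))).biUnion
        fun S => (Finset.powersetCard (2 * s) Finset.univ).biUnion fun T => Z S T).card : ℝ) ≤
        (1 / 4) ^ s * ((M : ℝ) ^ 4) ^ n := by
    intro s hs
    rw [Finset.mem_Icc] at hs
    have hZ : ∀ S ∈ Finset.powersetCard s (Finset.univ : Finset (Fin n)),
        ∀ T ∈ Finset.powersetCard (2 * s) (Finset.univ : Finset (Fin M)),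
        ((Z S T).card : ℝ) = ((2 * s : ℝ) ^ 4) ^ s * ((M : ℝ) ^ 4) ^ n / ((M : ℝ) ^ 4) ^ s := by
      intro S hS T hT
      have h := card_filter_map_into S T
      rw [Finset.mem_powersetCard_univ.1 hS, Finset.mem_powersetCard_univ.1 hT] at h
      rw [eq_div_iff (by positivity), h]
      push_cast
      rfl
    have h1 : (((Finset.powersetCard s (Finset.univ : Finset (Fin n))).biUnion
        fun S => (Finset.powersetCard (2 * s) Finset.univ).biUnion fun T => Z S T).card : ℝ) ≤
        ∑ S ∈ Finset.powersetCard s (Finset.univ : Finset (Fin n)),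
          ∑ T ∈ Finset.powersetCard (2 * s) (Finset.univ : Finset (Fin M)), ((Z S T).card : ℝ) := by
      exact_mod_cast Finset.card_biUnion_le.trans
        (Finset.sum_le_sum fun S _ => Finset.card_biUnion_le)
    rw [Finset.sum_congr rfl fun S hS => Finset.sum_congr rfl fun T hT => hZ S hS T hT,
      Finset.sum_const, Finset.sum_const, Finset.card_powersetCard, Finset.card_powersetCard,
      nsmul_eq_mul, nsmul_eq_mul, Finset.card_univ, Finset.card_univ, Fintype.card_fin,
      Fintype.card_fin] at h1
    refine h1.trans ?_
    rw [← mul_div_assoc, ← mul_div_assoc, div_le_iff₀ (by positivity)]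
    have h2 := choose_mul_choose_mul_le (n := n) (M := M) (s := s) (by omega) (by omega) hM3
    have h3 := mul_le_mul_of_nonneg_right h2 (by positivity : (0 : ℝ) ≤ ((M : ℝ) ^ 4) ^ n)
    calc _ = _ := by ring
      _ ≤ _ := h3
      _ = _ := by ring
  have hsum := Finset.sum_le_sum hterm
  rw [← Finset.sum_mul] at hsum
  have hcard : ((Finset.univ : Finset (Fin n × Fin 4 → Fin M)).card : ℝ) = ((M : ℝ) ^ 4) ^ n := by
    rw [Finset.card_univ, Fintype.card_fun, Fintype.card_prod, Fintype.card_fin, Fintype.card_fin,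
      Fintype.card_fin, mul_comm n 4, pow_mul]
    push_cast
    rfl
  have hle' : ((M : ℝ) ^ 4) ^ n ≤
      (∑ s ∈ Finset.Icc 1 (n / 4000), (1 / 4 : ℝ) ^ s) * ((M : ℝ) ^ 4) ^ n := by
    rw [← hcard] at hsum ⊢
    refine le_trans ?_ hsum
    exact_mod_cast hle
  have hpos : (0 : ℝ) < ((M : ℝ) ^ 4) ^ n := by positivity
  have := sum_Icc_one_fourth_pow_lt_one (n / 4000)
  nlinarith

/-! ### Good codes with encoders of linear size. -/

/-- Additivity of parity, which makes both `sparseMul` and `bitInner` linear over 𝔽₂. -/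
theorem decide_odd_card_filter_xor {ι : Type*} (I : Finset ι) (a b : ι → Bool) :
    decide (Odd (I.filter fun i => (a i ^^ b i) = true).card) =
      (decide (Odd (I.filter fun i => a i = true).card) ^^
        decide (Odd (I.filter fun i => b i = true).card)) := by
  classical
  induction I using Finset.induction_on with
  | empty => simp
  | insert i I hi ih =>
    have hni (c : ι → Bool) : i ∉ I.filter fun i => c i = true :=
      fun h => hi (Finset.mem_filter.1 h).1
    have hins (c : ι → Bool) : decide (Odd ((insert i I).filter fun i => c i = true).card) =
        (c i ^^ decide (Odd (I.filter fun i => c i = true).card)) := by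
      rw [Finset.filter_insert]
      cases hc : c i
      · simp
      · rw [if_pos rfl, Finset.card_insert_of_notMem (hni c)]
        simp [Nat.odd_add_one, -Nat.not_odd_iff_even]
    rw [hins a, hins b, hins fun i => (a i ^^ b i), ih]
    cases a i <;> cases b i <;> simp

theorem Derives.localFun {n m k : ℕ} {F : Set ((Fin n → Bool) → Bool)} (hF : F.Nonempty)
    (o : LocalFun m k) (z : Fin m → (Fin n → Bool) → Bool) (hz : ∀ i, z i ∈ F) :
    Derives F (4 ^ (k + 1)) {fun x => o.eval fun i => z i x} :=
  Derives.comp hF o.2 (fun l => z (o.1 l)) fun _ => hz _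

/-- 32 · (4/5)^16 ≈ 0.90, which is why 16n local functions suffice. -/
theorem two_pow_mul_sixteen_pow_mul_lt_one {n : ℕ} (hn : 0 < n) :
    (2 : ℝ) ^ n * 16 ^ n * (4 / 5) ^ (16 * n) < 1 := by
  rw [pow_mul, ← mul_pow, ← mul_pow]
  exact pow_lt_one₀ (by positivity) (by norm_num) hn.ne'

/-- The product of a vector with the sparse matrix over `𝔽₂` whose column `i` has ones in the rows
`f (i, l)`. -/
def sparseMul {n M d : ℕ} (f : Fin n × Fin d → Fin M) (x : Fin n → Bool) : Fin M → Bool :=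
  fun j => decide (Odd ((Finset.univ.filter fun p => f p = j).filter fun p => x p.1 = true).card)

/-- Each of the `n * d` entries belongs to one row and costs one xor; each of the `M` rows pays one
more gate for its constant. -/
theorem derives_sparseMul {n M d : ℕ} {F : Set ((Fin n → Bool) → Bool)} (hF : F.Nonempty)
    (hx : ∀ i, (fun x => x i) ∈ F) (f : Fin n × Fin d → Fin M) :
    Derives F (n * d + M) (Set.range fun j x => sparseMul f x j) := by
  have h := Derives.range _ (fun j x => sparseMul f x j) fun j =>
    Derives.parity hF (Finset.univ.filter fun p => f p = j) (fun p x => x p.1) fun p _ => hx _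
  refine h.mono_size (le_of_eq ?_)
  rw [Finset.sum_add_distrib, ← Finset.card_eq_sum_card_fiberwise fun p _ => Finset.mem_univ (f p)]
  simp

theorem sparseMul_ne {n M d : ℕ} (f : Fin n × Fin d → Fin M) {x y : Fin n → Bool} {j : Fin M}
    (h : Odd (((Finset.univ.filter fun i => x i ≠ y i) ×ˢ Finset.univ).filter
      fun p => f p = j).card) : sparseMul f x ≠ sparseMul f y := by
  intro he
  have h1 := decide_odd_card_filter_xor (Finset.univ.filter fun p => f p = j)
    (fun p : Fin n × Fin d => x p.1) (fun p => y p.1)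
  have h2 : ((Finset.univ.filter fun p => f p = j).filter
      fun p : Fin n × Fin d => (x p.1 ^^ y p.1) = true) =
      (((Finset.univ.filter fun i => x i ≠ y i) ×ˢ Finset.univ).filter fun p => f p = j) := by
    ext p
    simp [and_comm]
  rw [h2, decide_eq_true h] at h1
  have h3 := congrFun he j
  simp only [sparseMul] at h3
  rw [h3] at h1
  simp at h1

/-- Asymptotically good codes with encoding circuits of linear size. -/
theorem exists_linear_size_code : ∃ c : ℕ, ∀ n : ℕ, 0 < n → ∃ E : BoolCircuit n (17 * n),
    E.size ≤ c * n ∧ ∀ x y, x ≠ y →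
      (1 / 68000 : ℝ) * (17 * n : ℕ) ≤ (hammingDist (E.eval x) (E.eval y) : ℝ) := by
  obtain ⟨k, hk⟩ := exists_pow_lt_of_lt_one (show (0 : ℝ) < 1 / 15 by norm_num)
    (show (1 - 1 / 68000 : ℝ) < 1 by norm_num)
  -- Twice a bound on the cost per input bit of one level: at most 5 for the sparse product and 16 ·
  -- 4^(k+1) for the local functions. The same `k` serves all levels because the relative distance
  -- stays 1/68000, that is, n/4000 out of 17n.
  refine ⟨10 + 32 * 4 ^ (k + 1), fun n => ?_⟩
  induction n using Nat.strong_induction_on with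
  | _ n ih =>
  intro hn
  -- The recursion on `n / 2` needs `n ≥ 2`; a single bit is repeated 17 times.
  obtain rfl | hn2 : n = 1 ∨ 2 ≤ n := by omega
  · obtain ⟨C, hC, hCeval⟩ := (Computes.inputs 1).exists_circuit
      (fun (_ : Fin (17 * 1)) x => x 0) fun _ => ⟨0, rfl⟩
    refine ⟨C, hC.trans (Nat.zero_le _), fun x y hxy => ?_⟩
    have h0 : x 0 ≠ y 0 := fun h => hxy (funext fun i => by rwa [Subsingleton.elim i 0])
    have : hammingDist (C.eval x) (C.eval y) = 17 := by
      simp [hammingDist, hCeval, h0]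
    rw [this]
    norm_num
  obtain ⟨E, hEsize, hEdist⟩ := ih (n / 2) (by omega) (by omega)
  obtain ⟨f, hf⟩ := exists_sparse_check n hn2
  have hlarge : (2 : ℝ) ^ n * (Fintype.card (Fin (n / 2) → Bool) : ℝ) ^ 4 *
      (4 / 5) ^ (16 * n) < 1 := by
    refine lt_of_le_of_lt ?_ (two_pow_mul_sixteen_pow_mul_lt_one hn)
    rw [Fintype.card_fun, Fintype.card_fin, Fintype.card_bool, Nat.cast_pow, ← pow_mul,
      mul_comm (n / 2), pow_mul]
    norm_num
    gcongr
    exacts [by norm_num, Nat.div_le_self n 2]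
  obtain ⟨ω, hω⟩ := exists_localFun_odd (by omega) E.eval hEdist hk.le hlarge
  let v : Fin (16 * n) → (Fin n → Bool) → Bool := fun j x =>
    (ω j).eval fun i => E.eval (sparseMul f x) i
  have hF : (Set.range fun i (x : Fin n → Bool) => x i).Nonempty := ⟨_, ⟨0, hn⟩, rfl⟩
  have h1 := derives_sparseMul hF (fun i => ⟨i, rfl⟩) f
  have h2 := h1.trans (Derives.subst (F := _ ∪ _) E.gates (fun j x => sparseMul f x j)
    fun j => Or.inr ⟨j, rfl⟩)
  have h3 := h2.trans (Derives.range _ v fun j => Derives.localFun (F := _ ∪ _) hF.inl (ω j)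
    (fun i x => E.eval (sparseMul f x) i) fun i => Or.inr (Or.inr ⟨E.output i, rfl⟩))
  let e : Fin (17 * n) ≃ Fin n ⊕ Fin (16 * n) :=
    (finCongr (by omega)).trans finSumFinEquiv.symm
  let w : Fin n ⊕ Fin (16 * n) → (Fin n → Bool) → Bool := Sum.elim (fun i x => x i) v
  obtain ⟨C, hC, hCeval⟩ := (h3.computes (Computes.inputs n)).exists_circuit
    (fun i => w (e i)) fun i => by
      rcases e i with i | j
      · exact Or.inl ⟨i, rfl⟩
      · exact Or.inr (Or.inr ⟨j, rfl⟩)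
  refine ⟨C, hC.trans ?_, fun x y hxy => ?_⟩
  · rw [Finset.sum_const, Finset.card_univ, Fintype.card_fin, smul_eq_mul]
    have h4 : 2 * (n / 2) ≤ n := Nat.mul_div_le n 2
    have h5 := Nat.mul_le_mul_left (5 + 16 * 4 ^ (k + 1)) h4
    nlinarith
  have hdist {ι : Type} [Fintype ι] (a : ι → Fin n ⊕ Fin (16 * n)) (ha : a.Injective)
      (I : Finset ι) (hI : ∀ i ∈ I, w (a i) x ≠ w (a i) y) :
      I.card ≤ hammingDist (C.eval x) (C.eval y) := by
    refine Finset.card_le_card_of_injOn (fun i => e.symm (a i)) (fun i hi => ?_)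
      ((e.symm.injective.comp ha).injOn)
    simpa [hCeval] using hI i hi
  set S := Finset.univ.filter fun i => x i ≠ y i with hS
  have hSne : S.Nonempty := by
    obtain ⟨i, hi⟩ := Function.ne_iff.1 hxy
    exact ⟨i, by simpa [hS] using hi⟩
  suffices n ≤ 4000 * hammingDist (C.eval x) (C.eval y) by
    have : (n : ℝ) ≤ 4000 * hammingDist (C.eval x) (C.eval y) := by exact_mod_cast this
    push_cast
    linarith
  rcases le_total (4000 * S.card) n with hle | hle
  · obtain ⟨j, hj⟩ := hf S hSne hle
    have hne : sparseMul f x ≠ sparseMul f y := sparseMul_ne f hj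
    -- Odd parity on a two-point set means that the local function distinguishes the two points;
    -- here `t = n`, so at least n of them do.
    have h4 := hω {sparseMul f x, sparseMul f y} (by simp)
      ((Finset.card_le_two).trans (by norm_num))
    have h5 := h4.trans (hdist Sum.inr Sum.inr_injective _ fun j hj heq => ?_)
    · omega
    · have h6 := (Finset.mem_filter.1 hj).2
      change (ω j).eval (E.eval (sparseMul f x)) = (ω j).eval (E.eval (sparseMul f y)) at heq
      rw [Finset.filter_insert, Finset.filter_singleton, heq] at h6
      split_ifs at h6 with h7
      · rw [Finset.card_insert_of_notMem (by simpa using hne)] at h6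
        simp [Nat.odd_iff] at h6
      · simp at h6
  · have h4 := hdist Sum.inl Sum.inl_injective S fun i hi => (Finset.mem_filter.1 hi).2
    omega

/-! ### Linear independence over 𝔽₂ and uniform marginals. -/

theorem PMF.map_uniformOfFintype_of_card_fiber {S V : Type*} [Fintype S] [Nonempty S] [Fintype V]
    [Nonempty V] [DecidableEq V] (f : S → V) (c : ℕ)
    (hc : ∀ v, (Finset.univ.filter fun s => v = f s).card = c) :
    (PMF.uniformOfFintype S).map f = PMF.uniformOfFintype V := by
  have hcard : Fintype.card S = Fintype.card V * c := by
    rw [← Finset.card_univ, Finset.card_eq_sum_card_fiberwise (f := f) (t := Finset.univ)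
      fun s _ => Finset.mem_univ _]
    simp only [fun v => (Finset.filter_congr fun s _ => eq_comm :
      (Finset.univ.filter fun s => f s = v) = Finset.univ.filter fun s => v = f s), hc]
    simp
  have hc0 : c ≠ 0 := by
    rintro rfl
    exact Fintype.card_ne_zero (hcard.trans (mul_zero _))
  ext v
  rw [PMF.map_apply, tsum_fintype]
  simp only [PMF.uniformOfFintype_apply]
  have : ∑ s, (if v = f s then ((Fintype.card S : ENNReal))⁻¹ else 0) =
      c * (Fintype.card S : ENNReal)⁻¹ := by
    rw [← Finset.sum_filter, Finset.sum_const, hc, nsmul_eq_mul]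
  convert this using 1
  rw [hcard, Nat.cast_mul, ENNReal.mul_inv (Or.inl (by simp)) (Or.inl (by simp)), mul_left_comm,
    ENNReal.mul_inv_cancel (by simpa using hc0) (by simp), mul_one]

theorem bitInner_xor {r : ℕ} (a s t : Fin r → Bool) :
    bitInner a (fun i => s i ^^ t i) = (bitInner a s ^^ bitInner a t) := by
  have h := decide_odd_card_filter_xor (Finset.univ.filter fun i => a i = true) s t
  simpa only [Finset.filter_filter, bitInner] using h

/-- A family of rows with independent parities takes every vector of inner products. -/
theorem exists_bitInner_eq {κ : Type*} [Fintype κ] [DecidableEq κ] {r : ℕ} (H : κ → Fin r → Bool)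
    (hH : ∀ S : Finset κ, S.Nonempty → ∃ j, Odd (S.filter fun x => H x j = true).card)
    (b : κ → Bool) : ∃ s, ∀ x, bitInner (H x) s = b x := by
  let e : Bool → ZMod 2 := fun a => if a = true then 1 else 0
  let A : Matrix κ (Fin r) (ZMod 2) := fun x j => e (H x j)
  have hli : LinearIndependent (ZMod 2) A.row := by
    rw [Fintype.linearIndependent_iff]
    intro g hg
    by_contra! hne
    obtain ⟨x, hx⟩ := hne
    -- Over 𝔽₂ a linear combination of rows is the sum over its support, and some coordinate of that
    -- sum is odd.
    obtain ⟨j, hj⟩ := hH (Finset.univ.filter fun x => g x ≠ 0) ⟨x, by simpa using hx⟩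
    have h1 := congrFun hg j
    have hbit (z : ZMod 2) : z = if z ≠ 0 then 1 else 0 := by revert z; decide
    rw [Finset.sum_apply] at h1
    have h2 : ∀ x ∈ (Finset.univ : Finset κ), (g x • A.row x) j =
        if g x ≠ 0 ∧ H x j = true then 1 else 0 := by
      intro x _
      change g x * e (H x j) = _
      rw [hbit (g x)]
      by_cases h : g x = 0 <;> simp [h, e]
    rw [Finset.sum_congr rfl h2, Finset.sum_boole, ← Finset.filter_filter,
      (ZMod.natCast_eq_one_iff_odd).2 hj] at h1
    exact one_ne_zero h1
  -- Independent rows give full row rank, which equals the column rank, so the matrix maps onto all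
  -- of `κ → ZMod 2`.
  have hrange : A.mulVecLin.range = ⊤ := by
    apply Submodule.eq_top_of_finrank_eq
    have := hli.rank_matrix
    rw [Matrix.rank] at this
    rw [this, Module.finrank_fintype_fun_eq_card]
  obtain ⟨v, hv⟩ := LinearMap.range_eq_top.1 hrange fun x => e (b x)
  refine ⟨fun j => decide (v j ≠ 0), fun x => ?_⟩
  have h1 := congrFun hv x
  rw [Matrix.mulVecLin_apply, Matrix.mulVec, dotProduct] at h1
  have hbit (z : ZMod 2) : z = if z ≠ 0 then 1 else 0 := by revert z; decide
  have h2 : ∀ j ∈ (Finset.univ : Finset (Fin r)), A x j * v j =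
      if H x j = true ∧ decide (v j ≠ 0) = true then 1 else 0 := by
    intro j _
    change e (H x j) * v j = _
    rw [hbit (v j)]
    by_cases h : v j = 0 <;> simp [h, e]
  rw [Finset.sum_congr rfl h2, Finset.sum_boole] at h1
  unfold bitInner
  cases hb : b x
  · simp only [e, hb, Bool.false_eq_true, if_false] at h1
    rw [ZMod.natCast_eq_zero_iff_even] at h1
    simpa using h1
  · simp only [e, hb, if_true] at h1
    rw [ZMod.natCast_eq_one_iff_odd] at h1
    simpa using h1

/-- On `k` coordinates the generator is an 𝔽₂-linear surjection, so its fibres are cosets of the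
kernel and have equal size. -/
theorem isKWiseUniformGenerator_bitInner {ι : Type*} [DecidableEq ι] {r k : ℕ}
    (H : ι → Fin r → Bool) (hH : ∀ S : Finset ι, S.Nonempty → S.card ≤ k →
      ∃ j, Odd (S.filter fun x => H x j = true).card) :
    IsKWiseUniformGenerator k fun (s : Fin r → Bool) x => bitInner (H x) s := by
  intro T hT
  rw [PMF.map_comp]
  set f : (Fin r → Bool) → T → Bool := T.restrict ∘ fun s x => bitInner (H x) s with hf
  have hsurj (b : T → Bool) : ∃ s, f s = b := by
    obtain ⟨s, hs⟩ := exists_bitInner_eq (fun x : T => H x) (fun S hS => by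
      obtain ⟨j, hj⟩ := hH (S.map (Function.Embedding.subtype _)) (hS.map)
        (by rw [Finset.card_map, ← hT]; simpa using Finset.card_le_univ S)
      refine ⟨j, ?_⟩
      rw [Finset.filter_map, Finset.card_map] at hj
      exact hj) b
    exact ⟨s, funext hs⟩
  have hadd (s t : Fin r → Bool) : f (fun i => s i ^^ t i) = fun x => f s x ^^ f t x :=
    funext fun x => bitInner_xor _ s t
  refine PMF.map_uniformOfFintype_of_card_fiber f
    (Finset.univ.filter fun s => (fun _ => false) = f s).card fun v => ?_
  obtain ⟨t, rfl⟩ := hsurj v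
  -- Xor with `t` exchanges the fibre over `f t` and the kernel.
  refine Finset.card_nbij' (fun s i => s i ^^ t i) (fun s i => s i ^^ t i) ?_ ?_ ?_ ?_
  · intro s hs
    have hs' : f t = f s := by simpa using hs
    simp [hadd, ← hs']
  · intro s hs
    have hs' : (fun _ => false) = f s := by simpa using hs
    simp [hadd, ← hs']
  · intro s _
    simp
  · intro s _
    simp

/-! ### Assembly of the generator. -/

theorem mainTheorem4 :
    ∃ (c k : ℕ) (δ : ℝ), 0 < δ ∧ ∀ n : ℕ, 0 < n →
      ∃ G : (Fin (16 * n) → Bool) → (Fin n → Bool) → Bool,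
        -- `G` is a 4-wise uniform generator, locally computable in linear size
        IsKWiseUniformGenerator 4 G ∧
        (∀ s, ∃ C : BoolCircuit n 1, C.size ≤ c * n ∧ ∀ x, C.eval x 0 = G s x) ∧
        -- `G` has the following form, with `Enc` a good code of linear circuit size
        ∃ (m : ℕ) (Enc : BoolCircuit n m) (T : Fin (16 * n) → Finset (Fin m))
          (g : (i : Fin (16 * n)) → (T i → Bool) → Bool),
          m ≤ c * n ∧ Enc.size ≤ c * n ∧
          (∀ x y, x ≠ y → δ * (m : ℝ) ≤ (hammingDist (Enc.eval x) (Enc.eval y) : ℝ)) ∧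
          (∀ i, (T i).card ≤ k) ∧
          ∀ s x, G s x = bitInner (fun i => g i ((T i).restrict (Enc.eval x))) s := by
  obtain ⟨c, hc⟩ := exists_linear_size_code
  obtain ⟨k, hk⟩ := exists_pow_lt_of_lt_one (show (0 : ℝ) < 1 / 15 by norm_num)
    (show (1 - 1 / 68000 : ℝ) < 1 by norm_num)
  -- The code costs c·n, the 16n local functions 4^(k+1) each, and the final parity at most 16n + 1
  -- ≤ 17n; 17n is also the code length.
  refine ⟨c + 16 * 4 ^ (k + 1) + 17, k, 1 / 68000, by norm_num, fun n hn => ?_⟩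
  obtain ⟨E, hEsize, hEdist⟩ := hc n hn
  -- One odd coordinate is enough here, so `t = 1`.
  have hlarge : (2 : ℝ) ^ 1 * (Fintype.card (Fin n → Bool) : ℝ) ^ 4 * (4 / 5) ^ (16 * n) < 1 := by
    refine lt_of_le_of_lt ?_ (two_pow_mul_sixteen_pow_mul_lt_one hn)
    rw [Fintype.card_fun, Fintype.card_fin, Fintype.card_bool, Nat.cast_pow, ← pow_mul, mul_comm n,
      pow_mul]
    have : (2 : ℝ) ^ 1 ≤ 2 ^ n := pow_le_pow_right₀ (by norm_num) hn
    norm_num at this ⊢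
    gcongr
  obtain ⟨ω, hω⟩ := exists_localFun_odd (by omega) E.eval hEdist hk.le hlarge
  let H : (Fin n → Bool) → Fin (16 * n) → Bool := fun x j => (ω j).eval (E.eval x)
  refine ⟨fun s x => bitInner (H x) s, isKWiseUniformGenerator_bitInner H fun S hS hS4 => ?_,
    fun s => ?_, 17 * n, E, fun i => Finset.univ.image (ω i).1,
    fun i u => (ω i).2 fun l => u ⟨(ω i).1 l, Finset.mem_image_of_mem _ (Finset.mem_univ l)⟩,
    ?_, ?_, hEdist, fun i => ?_, fun s x => rfl⟩
  · obtain ⟨j, hj⟩ := Finset.card_pos.1 (hω S hS hS4)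
    exact ⟨j, (Finset.mem_filter.1 hj).2⟩
  · have hF : (Set.range fun i (x : Fin n → Bool) => x i).Nonempty := ⟨_, ⟨0, hn⟩, rfl⟩
    have h1 : Derives (Set.range fun i (x : Fin n → Bool) => x i) E.size _ :=
      Derives.subst E.gates (fun i x => x i) fun i => ⟨i, rfl⟩
    have h2 := h1.trans (Derives.range _ (fun j x => H x j) fun j =>
      Derives.localFun (F := _ ∪ _) hF.inl (ω j) (fun i x => E.eval x i)
        fun i => Or.inr ⟨E.output i, rfl⟩)
    have h3 := h2.trans (Derives.parity (F := _ ∪ _) hF.inl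
      (Finset.univ.filter fun i => s i = true) (fun j x => H x j)
      fun j _ => Or.inr (Or.inr ⟨j, rfl⟩))
    obtain ⟨C, hC, hCeval⟩ := (h3.computes (Computes.inputs n)).exists_circuit
      (fun _ : Fin 1 => fun x => bitInner (H x) s) fun _ => by
        refine Or.inr (Or.inr ?_)
        rw [Set.mem_singleton_iff]
        funext x
        simp only [bitInner, Finset.filter_filter, and_comm]
    refine ⟨C, hC.trans ?_, fun x => hCeval x 0⟩
    have hcard : (Finset.univ.filter fun i => s i = true).card ≤ 16 * n := by
      simpa using Finset.card_le_univ (Finset.univ.filter fun i => s i = true)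
    rw [Finset.sum_const, Finset.card_univ, Fintype.card_fin, smul_eq_mul]
    nlinarith
  · nlinarith [Nat.zero_le (c * n), Nat.zero_le (4 ^ (k + 1) * n)]
  · refine hEsize.trans ?_
    nlinarith [Nat.zero_le (c * n), Nat.zero_le (4 ^ (k + 1) * n)]
  · simpa using Finset.card_image_le (s := Finset.univ) (f := (ω i).1)
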